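/- Let $d>3$ and $\eta=(d-1)/4$, and consider the rank-$d$ tensorial field theory on $U(1)^d$ with propagator $C(\vec p\,)=\Theta(\Lambda^{2\eta}-\vec p^{\,2\eta})/(\vec p^{\,2\eta}+m^{2\eta})$, where $\vec p^{\,2\eta}=\sum_i|p_i|^{2\eta}$, and with the $d$ quartic melonic interactions, all of coupling $\lambda$. Work in the deep UV limit, in which sums over internal momenta in $\mathbb Z^{d-1}$ become integrals over $\mathbb R^{d-1}$, and keep only melonic Feynman diagrams, each vertex having weight $-2\lambda$. Write $\bar m^{2\eta}=m^{2\eta}\Lambda^{-2\eta}$ and $\iota(d)=2^{d-1}\,\Gamma\!\left(\frac{d+1}{d-1}\right)^{d-1}$. Fix a colour, say $1$. Let $Z=\partial\Gamma^{(2)}/\partial p_1^{2\eta}(\vec 0\,)=1-\tau'(0)$, where $\tau$ is the melonic self-energy of colour $1$, and let $\gamma^{(4)}$ be the zero-momentum 1PI melonic four-point function of colour $1$ (equal to $4\lambda$ at tree level). In $\tau'(0)=\partial\tau/\partial p^{2\eta}|_{p=0}$ the derivative of the cut-off is $\Theta'=\delta$ and products with $\delta$ are evaluated with the convention $\Theta(0)=0$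 on the cut-off surface; so on that surface only the loop line without insertions contributes, and the boundary term is $\iota(d)/(1+\bar m^{2\eta})$. These functions of $(\Lambda,\lambda,m^{2\eta})$ are considered on a connected open set $U\subset\{\Lambda>0\}$, on which they are real analytic, and on some non-empty open part of which $m^{2\eta}>0$ and they are the sums of their convergent melonic expansions. Let $U\subseteq W\subseteq\overline U$, and let $\beta,\beta_m,\gamma$ be continuous real functions on $W$ such that on $U$ the Callan–Symanzik equations $$\Big(\Lambda\frac{\partial}{\partial\Lambda}+\beta\frac{\partial}{\partial\lambda}+\beta_m\frac{\partial}{\partial m^{2\eta}}-\gamma\Big)Z=0,\qquad \Big(\Lambda\frac{\partial}{\partial\Lambda}+\beta\frac{\partial}{\partial\lambda}+\beta_m\frac{\partial}{\partial m^{2\eta}}-2\gamma\Big)\gamma^{(4)}=0$$ hold. Let $\beta_{\bar m}=\Lambda^{-2\eta}(\beta_m-2\eta\, m^{2\eta})$ be the beta function of the dimensionless mass. Then at every fixed point $\beta=\beta_{\bar m}=0$ in $W$ with $\Lambda>0$, $1+\bar m^{2\eta}\neq0$ and $1+\bar m^{2\eta}-2\lambda\,\iota(d)\neq 0$, one has (at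 least) one of 1. $\lambda=0$ (Gaussian fixed point), 2. $\gamma=0$ (vanishing anomalous dimension). -/

import Mathlib

noncomputable section

namespace TGFT

open MeasureTheory

/-- A point `(Λ, lam, M)` : ultraviolet cut-off `Λ`, bare quartic coupling `lam`, and bare mass
parameter `M = m^{2η}`. -/
abbrev Params : Type := ℝ × ℝ × ℝ

/-- The power `η = (d - 1) / 4` for which the rank `d` model is just renormalizable. -/
def eta (d : ℕ) : ℝ := ((d : ℝ) - 1) / 4

/-- `q^{2η} = ∑ᵢ |qᵢ|^{2η}`. -/
def kin (d : ℕ) {κ : Type} [Fintype κ] (q : κ → ℝ) : ℝ := ∑ i, |q i| ^ (2 * eta d)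

/-- `Λ^{2η}`. -/
def cutoffPow (d : ℕ) (x : Params) : ℝ := x.1 ^ (2 * eta d)

/-- The dimensionless mass parameter `m^{2η} / Λ^{2η}`. -/
def mbar (d : ℕ) (x : Params) : ℝ := x.2.2 / cutoffPow d x

/-- Heaviside's step function, with the convention `Θ(0) = 0`. -/
def heaviside (u : ℝ) : ℝ := if 0 < u then 1 else 0

/-- The bare propagator `Θ(Λ^{2η} - q^{2η}) / (q^{2η} + m^{2η})`. -/
def propagator (d : ℕ) (x : Params) (q : Fin d → ℝ) : ℝ :=
  heaviside (cutoffPow d x - kin d q) / (kin d q + x.2.2)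

/-- Ordered lists of melonic self-energy insertions on a line. `cons c s r` is the list whose first
insertion is the melonic two-point diagram of colour `c` (one quartic vertex of colour `c` closed by
one internal loop line, which in turn carries the list `s` of insertions), and whose remaining
insertions are `r`. Thus these lists are the plane rooted trees with edges coloured by
`1, …, d`, and for each colour `c` they also index the 1PI melonic two-point diagrams of
colour `c`, through the list carried by the loop line of the external vertex. -/
inductive Insertions (d : ℕ) : Type
  | nil : Insertions d
  | cons (c : Fin d) (s r : Insertions d) : Insertions d

/-- The momentum in `ℝ^d` with component `p` of colour `c` and the other components `y`. -/
def withColour {d : ℕ} (c : Fin d) (p : ℝ) (y : {j : Fin d // j ≠ c} → ℝ) : Fin d → ℝ :=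
  fun j => if h : j = c then p else y ⟨j, h⟩

/-- Amplitude of a line of momentum `q` with the given insertions, in the continuum (deep UV) theory,
where sums over internal momenta are integrals. Every vertex has weight `-2 lam` (two Wick
contractions per vertex), and the momentum of colour `c` flows along the external face of an
insertion of colour `c`. -/
def line (d : ℕ) (x : Params) : Insertions d → (Fin d → ℝ) → ℝ
  | .nil, q => propagator d x q
  | .cons c s r, q =>
      propagator d x q * (-2 * x.2.1 * ∫ y, line d x s (withColour c (q c) y)) * line d x r q

/-- Contribution to `τ(p)` of the melonic two-point diagram of colour `c` whose loop line carries the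
insertions `s`. -/
def selfEnergyAmp (d : ℕ) (x : Params) (c : Fin d) (s : Insertions d) (p : ℝ) : ℝ :=
  -2 * x.2.1 * ∫ y, line d x s (withColour c p y)

/-- `∫ dy δ(Λ^{2η} - y^{2η}) / (y^{2η} + m^{2η})` over the `d - 1` components of colour `≠ c`, where
`δ = Θ'`. -/
def cutoffSurfaceTerm (d : ℕ) (x : Params) (c : Fin d) : ℝ :=
  deriv (fun E : ℝ => ∫ y : {j : Fin d // j ≠ c} → ℝ,
    heaviside (E - kin d y) / (kin d y + x.2.2)) (cutoffPow d x)

/-- The boundary part of the derivative of a loop integral: a loop line with `k` insertions carries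
the factor `Θ^{k+1}`, whose derivative `(k + 1) Θ^k δ` is evaluated on the cut-off surface with
`Θ(0) = 0`, so that only `k = 0` contributes. -/
def boundaryTerm (d : ℕ) (x : Params) (c : Fin d) : Insertions d → ℝ
  | .nil => cutoffSurfaceTerm d x c
  | .cons _ _ _ => 0

/-- The bulk part (fixed cut-off) of the derivative of `line` with respect to `|q_c|^{2η}`, at a
momentum `q` with `q_c = 0`. By the product rule it acts on every propagator of the line, and on
every insertion whose external face has colour `c`; the derivative of such an insertion again has a
bulk and a boundary part. -/
def lineDeriv (d : ℕ) (x : Params) (c : Fin d) : Insertions d → (Fin d → ℝ) → ℝ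
  | .nil, q => -(propagator d x q) ^ 2
  | .cons c' s r, q =>
      -(propagator d x q) ^ 2 * selfEnergyAmp d x c' s (q c') * line d x r q
        + propagator d x q *
            (if c' = c then
              -2 * x.2.1 * ((∫ y, lineDeriv d x c s (withColour c 0 y)) - boundaryTerm d x c s)
             else 0) * line d x r q
        + propagator d x q * selfEnergyAmp d x c' s (q c') * lineDeriv d x c r q

/-- Contribution of one melonic two-point diagram of colour `c` to `τ'(0) = ∂τ/∂p^{2η}` at `p = 0`. -/
def slopeAmp (d : ℕ) (x : Params) (c : Fin d) (s : Insertions d) : ℝ :=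
  -2 * x.2.1 * ((∫ y, lineDeriv d x c s (withColour c 0 y)) - boundaryTerm d x c s)

/-- Amplitude at zero external momenta of a 1PI melonic four-point diagram of colour `c`: a chain of
vertices of colour `c`, consecutive ones being joined by a pair of lines that carry melonic
insertions. The list records these pairs; the chain with no pair is the vertex `4 lam`. -/
def fourPointAmp (d : ℕ) (x : Params) (c : Fin d) (l : List (Insertions d × Insertions d)) : ℝ :=
  4 * x.2.1 * (l.map fun t =>
    -2 * x.2.1 * ∫ y, line d x t.1 (withColour c 0 y) * line d x t.2 (withColour c 0 y)).prod

/-- `Z` and `g4` are the melonic vertex functions `∂Γ⁽²⁾/∂p_c^{2η}(0) = 1 - τ'(0)` and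
`γ⁽⁴⁾ = Γ⁽⁴⁾(0,0,0,0)` (colour `c`) on the connected region `U` of parameters: they are real analytic
on `U`, and on some non-empty open part `V` of `U` they are the sums of their (convergent) melonic
Feynman expansions. -/
structure IsMelonicVertexFunctions (d : ℕ) (c : Fin d) (U : Set Params) (Z g4 : Params → ℝ) :
    Prop where
  isOpen : IsOpen U
  isPreconnected : IsPreconnected U
  cutoff_pos : ∀ x ∈ U, 0 < x.1
  analytic_Z : AnalyticOnNhd ℝ Z U
  analytic_g4 : AnalyticOnNhd ℝ g4 U
  expansion : ∃ V ⊆ U, IsOpen V ∧ V.Nonempty ∧ ∀ x ∈ V, 0 < x.2.2 ∧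
    HasSum (slopeAmp d x c) (1 - Z x) ∧ HasSum (fourPointAmp d x c) (g4 x)

/-- The Callan-Symanzik equation at `x` for an `N`-point vertex function `F`:
`(Λ ∂/∂Λ + β ∂/∂lam + β_m ∂/∂m^{2η} - (N/2) γ) F = 0`. -/
def CallanSymanzik (β βm γ : Params → ℝ) (N : ℕ) (F : Params → ℝ) (x : Params) : Prop :=
  x.1 * fderiv ℝ F x (1, 0, 0) + β x * fderiv ℝ F x (0, 1, 0) + βm x * fderiv ℝ F x (0, 0, 1)
    - (N : ℝ) / 2 * γ x * F x = 0

/-- The beta function of the dimensionless mass: `Λ^{2η} β_{m̄} = β_m - 2η m^{2η}`. -/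
def betaMbar (d : ℕ) (βm : Params → ℝ) (x : Params) : ℝ :=
  (βm x - 2 * eta d * x.2.2) / cutoffPow d x

/-- `ι(d) = 2^{d-1} Γ((d+1)/(d-1))^{d-1}`. -/
def iota (d : ℕ) : ℝ := 2 ^ (d - 1) * Real.Gamma (((d : ℝ) + 1) / ((d : ℝ) - 1)) ^ (d - 1)

end TGFT

end

open MeasureTheory

namespace TGFT

variable {d : ℕ}

/-! The two vertex functions are tied by a Ward identity. Let `b` be the sum of all dressed bubbles
at zero momentum and `a = -2λb`. A chain of bubbles is a geometric series, so `γ⁽⁴⁾(1 - a) = 4λ`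
(`fourPoint_schwingerDyson`). Differentiating a loop line cuts it into two lines, producing the same
bubbles plus the surface term, so `Z(1 - a) = 1 - 2λι/(1 + m̄)` (`slope_schwingerDyson`).
Eliminating `a` gives `4λ(1 + m̄)Z = γ⁽⁴⁾(1 + m̄ - 2λι)` where the expansions converge, hence on all
of `U` by analyticity (`ward_identity`).

The Callan–Symanzik operator multiplies `Z` by `γ` and `γ⁽⁴⁾` by `2γ`. Applied to the Ward identity,
it yields a relation among `β`, `β_m̄` and `γ` from which `Z` cancels (`callanSymanzik_flow`). Since
`Z` is nonzero on a dense part of `U`, continuity carries the relation to the points of `W` with `Λ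
> 0`. At a fixed point it reads `γλ(1 + m̄)(1 + m̄ - 2λι) = 0`. -/

theorem kin_nonneg {κ : Type} [Fintype κ] (q : κ → ℝ) : 0 ≤ kin d q :=
  Finset.sum_nonneg fun _ _ => Real.rpow_nonneg (abs_nonneg _) _

theorem measurable_kin {κ : Type} [Fintype κ] : Measurable (kin d : (κ → ℝ) → ℝ) := by
  unfold kin
  fun_prop

theorem measurable_heaviside : Measurable heaviside :=
  Measurable.ite measurableSet_Ioi measurable_const measurable_const

theorem heaviside_nonneg (u : ℝ) : 0 ≤ heaviside u := by
  unfold heaviside; split_ifs <;> norm_num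

theorem heaviside_le_one (u : ℝ) : heaviside u ≤ 1 := by
  unfold heaviside; split_ifs <;> norm_num

theorem heaviside_mono {u v : ℝ} (h : u ≤ v) : heaviside u ≤ heaviside v := by
  unfold heaviside
  split_ifs with h1 h2
  · rfl
  · exact absurd (h1.trans_le h) h2
  · norm_num
  · rfl

theorem withColour_self (c : Fin d) (p : ℝ) (y : {j : Fin d // j ≠ c} → ℝ) :
    withColour c p y c = p := by simp [withColour]

theorem measurable_withColour (c : Fin d) :
    Measurable fun z : ℝ × ({j : Fin d // j ≠ c} → ℝ) => withColour c z.1 z.2 := by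
  refine measurable_pi_lambda _ fun j => ?_
  unfold withColour
  split_ifs <;> fun_prop

theorem kin_withColour (c : Fin d) (p : ℝ) (y : {j : Fin d // j ≠ c} → ℝ) :
    kin d (withColour c p y) = |p| ^ (2 * eta d) + kin d y := by
  unfold kin
  rw [Fintype.sum_eq_add_sum_subtype_ne _ c, withColour_self]
  congr 1
  refine Finset.sum_congr rfl fun j _ => ?_
  simp [withColour, j.2]

/-! ### Volumes of kinetic balls and the cut-off surface term -/

theorem eta_pos (hd : 3 < d) : 0 < eta d := by
  have : (3 : ℝ) < d := by exact_mod_cast hd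
  unfold eta; linarith

/-- The ball of squared radius `E` for the kinetic function has volume `ι(d) E² / 2`. -/
theorem volume_kin_lt (hd : 3 < d) (c : Fin d) {E : ℝ} (hE : 0 < E) :
    volume {y : {j : Fin d // j ≠ c} → ℝ | kin d y < E} = ENNReal.ofReal (iota d / 2 * E ^ 2) := by
  have hd' : (3 : ℝ) < d := by exact_mod_cast hd
  have hη : 0 < 2 * eta d := by have := eta_pos hd; linarith
  have hcard : Fintype.card {j : Fin d // j ≠ c} = d - 1 := by
    simp [Fintype.card_subtype_compl]
  have hcast : ((d - 1 : ℕ) : ℝ) = (d : ℝ) - 1 := by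
    rw [Nat.cast_sub (by omega)]; simp
  have : Nonempty {j : Fin d // j ≠ c} := Fintype.card_pos_iff.1 (by omega)
  have h := volume_sum_rpow_lt {j : Fin d // j ≠ c} (p := 2 * eta d)
    (by unfold eta; linarith) (E ^ (1 / (2 * eta d)))
  have hset : {y : {j : Fin d // j ≠ c} → ℝ | (∑ i, |y i| ^ (2 * eta d)) ^ (1 / (2 * eta d)) <
      E ^ (1 / (2 * eta d))} = {y | kin d y < E} := by
    ext y
    exact Real.rpow_lt_rpow_iff (kin_nonneg y) hE.le (by positivity)
  rw [hset, hcard, ← ENNReal.ofReal_pow (by positivity), ← ENNReal.ofReal_mul (by positivity)] at h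
  rw [h]
  congr 1
  -- Since `d - 1 = 4η`, the volume scales as `E²`, and the denominator `Γ((d - 1)/(2η) + 1)` is
  -- `Γ(3) = 2`.
  have h1 : (E ^ (1 / (2 * eta d))) ^ (d - 1) = E ^ 2 := by
    rw [← Real.rpow_natCast, ← Real.rpow_mul hE.le, ← Real.rpow_natCast, hcast]
    congr 1
    unfold eta
    have : (d : ℝ) - 1 ≠ 0 := by linarith
    push_cast
    field_simp
    norm_num
  have h2 : ((d - 1 : ℕ) : ℝ) / (2 * eta d) + 1 = (2 : ℕ) + 1 := by
    rw [hcast]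
    unfold eta
    have : (d : ℝ) - 1 ≠ 0 := by linarith
    push_cast
    field_simp
    norm_num
  have h3 : 1 / (2 * eta d) + 1 = ((d : ℝ) + 1) / ((d : ℝ) - 1) := by
    unfold eta
    have : (d : ℝ) - 1 ≠ 0 := by linarith
    field_simp
    ring
  rw [h1, h2, h3, Real.Gamma_nat_eq_factorial, iota, mul_pow]
  norm_num
  ring

theorem iota_pos (hd : 3 < d) : 0 < iota d := by
  have hd' : (3 : ℝ) < d := by exact_mod_cast hd
  have : 0 < Real.Gamma (((d : ℝ) + 1) / ((d : ℝ) - 1)) :=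
    Real.Gamma_pos_of_pos (div_pos (by linarith) (by linarith))
  unfold iota
  positivity

theorem heaviside_sub_kin_eq_indicator {κ : Type} [Fintype κ] (E : ℝ) :
    (fun y : κ → ℝ => heaviside (E - kin d y)) =
      Set.indicator {y : κ → ℝ | kin d y < E} fun _ => (1 : ℝ) := by
  ext y
  simp [heaviside, Set.indicator_apply]

theorem integrable_heaviside (hd : 3 < d) (c : Fin d) {E : ℝ} (hE : 0 < E) :
    Integrable fun y : {j : Fin d // j ≠ c} → ℝ => heaviside (E - kin d y) := by
  rw [heaviside_sub_kin_eq_indicator]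
  refine IntegrableOn.integrable_indicator ?_ (measurable_kin measurableSet_Iio)
  exact integrableOn_const (by rw [volume_kin_lt hd c hE]; exact ENNReal.ofReal_ne_top)

theorem integral_heaviside (hd : 3 < d) (c : Fin d) {E : ℝ} (hE : 0 < E) :
    ∫ y : {j : Fin d // j ≠ c} → ℝ, heaviside (E - kin d y) = iota d / 2 * E ^ 2 := by
  have hset : MeasurableSet {y : {j : Fin d // j ≠ c} → ℝ | kin d y < E} :=
    measurable_kin measurableSet_Iio
  rw [heaviside_sub_kin_eq_indicator, integral_indicator_const _ hset, measureReal_def, volume_kin_lt hd c hE, smul_eq_mul, mul_one, ENNReal.toReal_ofReal]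
  have := iota_pos hd
  positivity

theorem abs_heaviside_div_le {κ : Type} [Fintype κ] {M : ℝ} (hM : 0 < M) (E : ℝ) (q : κ → ℝ) :
    |heaviside (E - kin d q) / (kin d q + M)| ≤ 1 / M * heaviside (E - kin d q) := by
  have hk := kin_nonneg (d := d) q
  have hh := heaviside_nonneg (E - kin d q)
  rw [abs_of_nonneg (by positivity), div_eq_inv_mul, ← one_div]
  gcongr
  linarith

theorem integrable_heaviside_div (hd : 3 < d) (c : Fin d) {E M : ℝ} (hE : 0 < E) (hM : 0 < M) :
    Integrable fun y : {j : Fin d // j ≠ c} → ℝ => heaviside (E - kin d y) / (kin d y + M) := by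
  refine ((integrable_heaviside hd c hE).const_mul (1 / M)).mono' ?_
    (Filter.Eventually.of_forall fun y => abs_heaviside_div_le hM E y)
  exact ((measurable_heaviside.comp (measurable_const.sub measurable_kin)).div
    (measurable_kin.add_const M)).aestronglyMeasurable

/-- The increments of `E ↦ ∫ Θ(E - y^{2η}) / (y^{2η} + M) dy`, bracketed by volumes. -/
theorem integral_heaviside_div_sub_mem (hd : 3 < d) (c : Fin d) {a b M : ℝ} (ha : 0 < a)
    (hab : a ≤ b) (hM : 0 < M) :
    (∫ y : {j : Fin d // j ≠ c} → ℝ, heaviside (b - kin d y) / (kin d y + M)) -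
      (∫ y : {j : Fin d // j ≠ c} → ℝ, heaviside (a - kin d y) / (kin d y + M)) ∈
    Set.Icc ((iota d / 2 * b ^ 2 - iota d / 2 * a ^ 2) / (b + M))
      ((iota d / 2 * b ^ 2 - iota d / 2 * a ^ 2) / (a + M)) := by
  have hb : 0 < b := ha.trans_le hab
  have ia := integrable_heaviside hd c ha
  have ib := integrable_heaviside hd c hb
  have ja := integrable_heaviside_div hd c ha hM
  have jb := integrable_heaviside_div hd c hb hM
  rw [← integral_heaviside hd c ha, ← integral_heaviside hd c hb, ← integral_sub ib ia,
    ← integral_sub jb ja, ← integral_div, ← integral_div]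
  constructor
  · refine integral_mono ((ib.sub ia).div_const _) (jb.sub ja) fun y => ?_
    have hk := kin_nonneg (d := d) y
    simp only [← sub_div]
    by_cases h : kin d y < b
    · have := heaviside_mono (sub_le_sub_right hab (kin d y))
      exact div_le_div_of_nonneg_left (by linarith) (by linarith) (by linarith)
    · have h' : ¬ kin d y < a := fun h'' => h (h''.trans_le hab)
      simp [heaviside, h, h']
  · refine integral_mono (jb.sub ja) ((ib.sub ia).div_const _) fun y => ?_
    have hk := kin_nonneg (d := d) y
    simp only [← sub_div]
    by_cases h : kin d y < a
    · simp [heaviside, h, h.trans_le hab]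
    · have := heaviside_mono (sub_le_sub_right hab (kin d y))
      exact div_le_div_of_nonneg_left (by linarith) (by linarith) (by linarith)

/-- On a thin shell the denominator is nearly constant, so the difference quotient is squeezed
between two quotients of shell volumes with the same limit. This avoids a surface measure. -/
theorem hasDerivAt_integral_heaviside_div (hd : 3 < d) (c : Fin d) {E M : ℝ} (hE : 0 < E)
    (hM : 0 < M) :
    HasDerivAt (fun E : ℝ => ∫ y : {j : Fin d // j ≠ c} → ℝ,
      heaviside (E - kin d y) / (kin d y + M)) (iota d * E / (E + M)) E := by
  have hι := iota_pos hd
  have hlim : ∀ u : ℝ → ℝ, Filter.Tendsto u (nhdsWithin E {E}ᶜ) (nhds (E + M)) →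
      Filter.Tendsto (fun b => iota d / 2 * (b + E) / u b) (nhdsWithin E {E}ᶜ)
        (nhds (iota d * E / (E + M))) := by
    intro u hu
    have h1 : Filter.Tendsto (fun b : ℝ => iota d / 2 * (b + E)) (nhdsWithin E {E}ᶜ)
        (nhds (iota d / 2 * (E + E))) :=
      ((by fun_prop : Continuous fun b : ℝ => iota d / 2 * (b + E)).tendsto E).mono_left
        nhdsWithin_le_nhds
    have h2 : iota d / 2 * (E + E) / (E + M) = iota d * E / (E + M) := by ring
    rw [← h2]
    exact h1.div hu (by positivity)
  have hid : Filter.Tendsto (fun b : ℝ => b + M) (nhdsWithin E {E}ᶜ) (nhds (E + M)) :=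
    ((by fun_prop : Continuous fun b : ℝ => b + M).tendsto E).mono_left nhdsWithin_le_nhds
  have hl := (hlim _ hid).min (hlim _ tendsto_const_nhds)
  have hr := (hlim _ hid).max (hlim _ tendsto_const_nhds)
  rw [min_self] at hl
  rw [max_self] at hr
  rw [hasDerivAt_iff_tendsto_slope]
  have hmem : ∀ᶠ b in nhdsWithin E {E}ᶜ, 0 < b ∧ b ≠ E :=
    ((lt_mem_nhds hE).filter_mono nhdsWithin_le_nhds).and self_mem_nhdsWithin
  -- The order of the two bounds depends on the side from which `b` approaches `E`, hence the
  -- unordered interval.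
  have key : ∀ᶠ b in nhdsWithin E {E}ᶜ, slope (fun E : ℝ => ∫ y : {j : Fin d // j ≠ c} → ℝ,
      heaviside (E - kin d y) / (kin d y + M)) E b ∈
      Set.uIcc (iota d / 2 * (b + E) / (b + M)) (iota d / 2 * (b + E) / (E + M)) := by
    filter_upwards [hmem] with b hb
    rw [slope_def_field]
    rcases lt_or_gt_of_ne hb.2 with h | h
    · have hh := integral_heaviside_div_sub_mem hd c hb.1 h.le hM
      rw [Set.uIcc_comm]
      refine Set.Icc_subset_uIcc ?_
      rw [← neg_div_neg_eq (_ - _) (b - E), neg_sub, neg_sub]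
      have hs : 0 < E - b := by linarith
      refine ⟨(le_div_iff₀ hs).2 (le_of_eq_of_le ?_ hh.1), (div_le_iff₀ hs).2 (hh.2.trans_eq ?_)⟩ <;>
        ring
    · have hh := integral_heaviside_div_sub_mem hd c hE h.le hM
      refine Set.Icc_subset_uIcc ?_
      have hs : 0 < b - E := by linarith
      refine ⟨(le_div_iff₀ hs).2 (le_of_eq_of_le ?_ hh.1), (div_le_iff₀ hs).2 (hh.2.trans_eq ?_)⟩ <;>
        ring
  exact tendsto_of_tendsto_of_tendsto_of_le_of_le' hl hr (key.mono fun b hb => hb.1)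
    (key.mono fun b hb => hb.2)

theorem cutoffPow_pos {x : Params} (hΛ : 0 < x.1) : 0 < cutoffPow d x :=
  Real.rpow_pos_of_pos hΛ _

theorem one_add_mbar {x : Params} (hΛ : 0 < x.1) :
    1 + mbar d x = (cutoffPow d x + x.2.2) / cutoffPow d x := by
  have := cutoffPow_pos (d := d) hΛ
  unfold mbar
  field_simp

theorem cutoffSurfaceTerm_eq (hd : 3 < d) (c : Fin d) {x : Params} (hΛ : 0 < x.1)
    (hM : 0 < x.2.2) : cutoffSurfaceTerm d x c = iota d / (1 + mbar d x) := by
  unfold cutoffSurfaceTerm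
  rw [(hasDerivAt_integral_heaviside_div hd c (cutoffPow_pos hΛ) hM).deriv, one_add_mbar hΛ,
    div_div_eq_mul_div]

/-! ### Measurability and bounds of lines -/

theorem measurable_propagator (x : Params) : Measurable (propagator d x) :=
  (measurable_heaviside.comp (measurable_const.sub measurable_kin)).div
    (measurable_kin.add_const _)

theorem line_cons (x : Params) (c : Fin d) (s r : Insertions d) (q : Fin d → ℝ) :
    line d x (.cons c s r) q = propagator d x q * selfEnergyAmp d x c s (q c) * line d x r q := rfl

theorem measurable_line (x : Params) (s : Insertions d) : Measurable (line d x s) := by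
  induction s with
  | nil => exact measurable_propagator x
  | cons c s r hs hr =>
    refine ((measurable_propagator x).mul ?_).mul hr
    have : StronglyMeasurable fun p : ℝ => ∫ y, line d x s (withColour c p y) :=
      StronglyMeasurable.integral_prod_right
        (f := fun (p : ℝ) (y : {j : Fin d // j ≠ c} → ℝ) => line d x s (withColour c p y))
        (hs.comp (measurable_withColour c)).stronglyMeasurable
    exact (this.measurable.comp (measurable_pi_apply c)).const_mul _

theorem heaviside_withColour_le (E : ℝ) (c : Fin d) (p : ℝ) (y : {j : Fin d // j ≠ c} → ℝ) :
    heaviside (E - kin d (withColour c p y)) ≤ heaviside (E - kin d y) := by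
  refine heaviside_mono ?_
  rw [kin_withColour]
  have := Real.rpow_nonneg (abs_nonneg p) (2 * eta d)
  linarith

/-- Each propagator is at most `1/M`, and each self-energy is bounded uniformly in its external
momentum because that momentum only shrinks the cut-off region. The last propagator supplies the
compact support needed for integrability. -/
theorem exists_abs_line_le (hd : 3 < d) {x : Params} (hΛ : 0 < x.1) (hM : 0 < x.2.2)
    (s : Insertions d) :
    ∃ K, 0 ≤ K ∧ ∀ q, |line d x s q| ≤ K * heaviside (cutoffPow d x - kin d q) := by
  induction s with
  | nil => exact ⟨1 / x.2.2, by positivity, fun q => abs_heaviside_div_le hM _ q⟩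
  | cons c s r hs hr =>
    obtain ⟨K, hK, hs⟩ := hs
    obtain ⟨L, hL, hr⟩ := hr
    set I := ∫ y : {j : Fin d // j ≠ c} → ℝ, K * heaviside (cutoffPow d x - kin d y) with hI
    have hI0 : 0 ≤ I := integral_nonneg fun y => mul_nonneg hK (heaviside_nonneg _)
    have hτ : ∀ p, |selfEnergyAmp d x c s p| ≤ |-2 * x.2.1| * I := by
      intro p
      unfold selfEnergyAmp
      rw [abs_mul]
      refine mul_le_mul_of_nonneg_left ?_ (abs_nonneg _)
      refine norm_integral_le_of_norm_le (f := fun y => line d x s (withColour c p y))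
        ((integrable_heaviside hd c (cutoffPow_pos (d := d) hΛ)).const_mul K)
        (Filter.Eventually.of_forall fun y => ?_)
      exact (hs (withColour c p y)).trans
        (mul_le_mul_of_nonneg_left (heaviside_withColour_le _ _ _ _) hK)
    refine ⟨1 / x.2.2 * (|-2 * x.2.1| * I) * L, by positivity, fun q => ?_⟩
    rw [line_cons, abs_mul, abs_mul, mul_assoc (_ * _) L]
    have hprop : |propagator d x q| ≤ 1 / x.2.2 :=
      (abs_heaviside_div_le hM _ q).trans
        (mul_le_of_le_one_right (by positivity) (heaviside_le_one _))
    exact mul_le_mul (mul_le_mul hprop (hτ _) (abs_nonneg _) (by positivity)) (hr q)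
      (abs_nonneg _) (by positivity)

/-- The bubble at zero external momentum, with insertions `s` and `t` on its two lines. -/
noncomputable def bubble (d : ℕ) (x : Params) (c : Fin d) (t : Insertions d × Insertions d) : ℝ :=
  ∫ y, line d x t.1 (withColour c 0 y) * line d x t.2 (withColour c 0 y)

theorem integrable_line_mul_line (hd : 3 < d) {x : Params} (hΛ : 0 < x.1) (hM : 0 < x.2.2)
    (c : Fin d) (s t : Insertions d) :
    Integrable fun y => line d x s (withColour c 0 y) * line d x t (withColour c 0 y) := by
  obtain ⟨K, hK, hs⟩ := exists_abs_line_le hd hΛ hM s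
  obtain ⟨L, hL, ht⟩ := exists_abs_line_le hd hΛ hM t
  have hmeas : Measurable fun y : {j : Fin d // j ≠ c} → ℝ => withColour c 0 y :=
    (measurable_withColour c).comp (measurable_const.prodMk measurable_id)
  refine ((integrable_heaviside hd c (cutoffPow_pos (d := d) hΛ)).const_mul (K * L)).mono'
    (((measurable_line x s).comp hmeas).mul
      ((measurable_line x t).comp hmeas)).aestronglyMeasurable
    (Filter.Eventually.of_forall fun y => ?_)
  have hw := heaviside_withColour_le (cutoffPow d x) c 0 y
  have h0 := heaviside_nonneg (cutoffPow d x - kin d (withColour c 0 y))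
  have h1 := heaviside_le_one (cutoffPow d x - kin d (withColour c 0 y))
  rw [Real.norm_eq_abs, abs_mul, mul_assoc, mul_left_comm]
  calc _ ≤ (K * heaviside (cutoffPow d x - kin d (withColour c 0 y))) * (L * 1) :=
        mul_le_mul (hs _) ((ht _).trans (mul_le_mul_of_nonneg_left h1 hL)) (abs_nonneg _)
          (by positivity)
    _ ≤ (K * heaviside (cutoffPow d x - kin d y)) * (L * 1) := by gcongr
    _ = _ := by ring

theorem hasSum_congr_real {ι : Type*} {f g : ι → ℝ} {a : ℝ} (h : ∀ i, f i = g i) :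
    HasSum f a ↔ HasSum g a := by
  rw [funext h]

/-! ### Splittings of a line into two lines -/

/-- Concatenation of lists of insertions. -/
def append : Insertions d → Insertions d → Insertions d
  | .nil, t => t
  | .cons c s r, t => .cons c s (append r t)

/-- Prepend an insertion to the first list of a pair. -/
def consFst (c : Fin d) (s : Insertions d) :
    Insertions d × Insertions d ↪ Insertions d × Insertions d where
  toFun p := (.cons c s p.1, p.2)
  inj' p q h := by
    obtain ⟨h1, h2⟩ := Prod.mk.inj h
    exact Prod.ext (Insertions.cons.inj h1).2.2 h2

theorem consFst_apply (c : Fin d) (s : Insertions d) (p : Insertions d × Insertions d) :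
    consFst c s p = (.cons c s p.1, p.2) := rfl

/-- The ways of writing a list of insertions as a concatenation. -/
def splits : Insertions d → Finset (Insertions d × Insertions d)
  | .nil => {(.nil, .nil)}
  | .cons c s r => Finset.cons (.nil, .cons c s r) ((splits r).map (consFst c s)) (by
      simp [consFst_apply])

theorem mem_splits (l : Insertions d) : ∀ p, p ∈ splits l ↔ append p.1 p.2 = l := by
  induction l with
  | nil =>
    rintro ⟨_ | ⟨c, s, r⟩, t⟩ <;> simp [splits, append]
  | cons c s r _ hr =>
    rintro ⟨_ | ⟨c', s', r'⟩, t⟩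
    · simp [splits, append, consFst_apply]
    · have := hr (r', t)
      simp only [splits, append, consFst_apply, Finset.mem_cons, Finset.mem_map, Prod.mk.injEq,
        reduceCtorEq, false_and, false_or, Prod.exists,
        Insertions.cons.injEq] at this ⊢
      constructor
      · rintro ⟨a, b, h, ⟨h1, h2, rfl⟩, rfl⟩
        exact ⟨h1.symm, h2.symm, this.1 h⟩
      · rintro ⟨rfl, rfl, h⟩
        exact ⟨r', t, this.2 h, ⟨rfl, rfl, rfl⟩, rfl⟩

/-- Summing over pairs of lists is summing over all splittings of all lists. -/
theorem hasSum_sum_splits {f : Insertions d × Insertions d → ℝ} {a : ℝ} (hf : HasSum f a) :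
    HasSum (fun l => ∑ p ∈ splits l, f p) a := by
  have h := hf.tsum_fiberwise fun p => append p.1 p.2
  refine (hasSum_congr_real fun l => ?_).2 h
  have hl : (fun p : Insertions d × Insertions d => append p.1 p.2) ⁻¹' {l} = splits l := by
    ext p
    simp [mem_splits]
  rw [hl]
  exact (Finset.tsum_subtype (splits l) f).symm

/-- The derivative of the first insertion of a line, if it has colour `c`, times the remaining
insertions, whose value is given by `f`. -/
noncomputable def headSlope (d : ℕ) (x : Params) (c : Fin d) (f : Insertions d → ℝ) :
    Insertions d → ℝ
  | .nil => 0
  | .cons c' s r => if c' = c then slopeAmp d x c s * f r else 0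

theorem lineDeriv_cons (x : Params) (c c' : Fin d) (s r : Insertions d) (q : Fin d → ℝ) :
    lineDeriv d x c (.cons c' s r) q =
      -(propagator d x q) ^ 2 * selfEnergyAmp d x c' s (q c') * line d x r q
        + propagator d x q * (if c' = c then slopeAmp d x c s else 0) * line d x r q
        + propagator d x q * selfEnergyAmp d x c' s (q c') * lineDeriv d x c r q := rfl

/-- The product rule as a sum over cuts: a cut selects a propagator and the insertion following it,
if any. Differentiating the propagator doubles it, giving minus the product of two complete lines;
differentiating the insertion replaces it by its slope. -/
theorem lineDeriv_eq_sum_splits (x : Params) (c : Fin d) (l : Insertions d) (q : Fin d → ℝ) :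
    lineDeriv d x c l q = ∑ p ∈ splits l,
      line d x p.1 q * (headSlope d x c (fun r => line d x r q) p.2 - line d x p.2 q) := by
  induction l with
  | nil =>
    simp only [splits, Finset.sum_singleton, headSlope, lineDeriv, line]
    ring
  | cons c' s r _ hr =>
    rw [lineDeriv_cons, hr, splits, Finset.sum_cons, Finset.sum_map, Finset.mul_sum]
    congr 1
    · simp only [headSlope, line_cons, line.eq_1]
      split_ifs <;> ring
    · refine Finset.sum_congr rfl fun p _ => ?_
      simp only [consFst_apply, line_cons]
      ring

theorem bubble_eq (x : Params) (c : Fin d) (s t : Insertions d) :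
    bubble d x c (s, t) = ∫ y, line d x s (withColour c 0 y) * line d x t (withColour c 0 y) := rfl

theorem integrable_line_mul_headSlope_sub (hd : 3 < d) {x : Params} (hΛ : 0 < x.1)
    (hM : 0 < x.2.2) (c : Fin d) (s t : Insertions d) :
    Integrable (fun y => line d x s (withColour c 0 y) *
      (headSlope d x c (fun r => line d x r (withColour c 0 y)) t -
        line d x t (withColour c 0 y))) ∧
    ∫ y, line d x s (withColour c 0 y) *
      (headSlope d x c (fun r => line d x r (withColour c 0 y)) t -
        line d x t (withColour c 0 y)) =
      headSlope d x c (fun r => bubble d x c (s, r)) t - bubble d x c (s, t) := by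
  have hst := integrable_line_mul_line hd hΛ hM c s t
  have key : Integrable (fun y => line d x s (withColour c 0 y) *
      headSlope d x c (fun r => line d x r (withColour c 0 y)) t) ∧
      ∫ y, line d x s (withColour c 0 y) *
        headSlope d x c (fun r => line d x r (withColour c 0 y)) t =
        headSlope d x c (fun r => bubble d x c (s, r)) t := by
    cases t with
    | nil => simp [headSlope]
    | cons c' t r =>
      have hsr := integrable_line_mul_line hd hΛ hM c s r
      simp only [headSlope]
      split_ifs
      · simp only [mul_left_comm _ (slopeAmp d x c t)]
        exact ⟨hsr.const_mul _, integral_const_mul _ _⟩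
      · simp
  simp only [mul_sub]
  exact ⟨key.1.sub hst, by rw [integral_sub key.1 hst, key.2, bubble_eq]⟩

theorem integral_lineDeriv (hd : 3 < d) {x : Params} (hΛ : 0 < x.1)
    (hM : 0 < x.2.2) (c : Fin d) (l : Insertions d) :
    ∫ y, lineDeriv d x c l (withColour c 0 y) = ∑ p ∈ splits l,
      (headSlope d x c (fun r => bubble d x c (p.1, r)) p.2 - bubble d x c p) := by
  simp only [lineDeriv_eq_sum_splits]
  rw [integral_finsetSum]
  · exact Finset.sum_congr rfl fun p _ =>
      (integrable_line_mul_headSlope_sub hd hΛ hM c p.1 p.2).2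
  · exact fun p _ => (integrable_line_mul_headSlope_sub hd hΛ hM c p.1 p.2).1

/-! ### Schwinger–Dyson equations -/

/-- A nonzero term is a bubble with a colour-`c` insertion placed at the start of its second line,
so the series is the product of the bubble and slope series, reindexed. -/
theorem hasSum_headSlope {x : Params} {c : Fin d} {b τ : ℝ} (hb : HasSum (bubble d x c) b)
    (hτ : HasSum (slopeAmp d x c) τ) :
    HasSum (fun p : Insertions d × Insertions d =>
      headSlope d x c (fun r => bubble d x c (p.1, r)) p.2) (b * τ) := by
  have h := hb.mul hτ (summable_mul_of_summable_norm hb.summable.norm hτ.summable.norm)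
  let g : (Insertions d × Insertions d) × Insertions d → Insertions d × Insertions d :=
    fun u => (u.1.1, .cons c u.2 u.1.2)
  have hg : Function.Injective g := by
    rintro ⟨⟨s, r⟩, t⟩ ⟨⟨s', r'⟩, t'⟩ h
    simp only [g, Prod.mk.injEq, Insertions.cons.injEq] at h
    obtain ⟨rfl, -, rfl, rfl⟩ := h
    rfl
  rw [← hg.hasSum_iff]
  · refine (hasSum_congr_real fun u => ?_).2 h
    simp [g, headSlope, mul_comm]
  · rintro ⟨s, _ | ⟨c', t, r⟩⟩ hp
    · rfl
    · refine if_neg fun hc => hp ⟨((s, r), t), ?_⟩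
      simp only [g, hc]

/-- The Schwinger–Dyson equation for the slope of the melonic self-energy. -/
theorem slope_schwingerDyson (hd : 3 < d) {x : Params} (hΛ : 0 < x.1) (hM : 0 < x.2.2)
    {c : Fin d} {b τ : ℝ} (hb : HasSum (bubble d x c) b) (hτ : HasSum (slopeAmp d x c) τ) :
    τ = -2 * x.2.1 * (b * τ - b - iota d / (1 + mbar d x)) := by
  have h1 := hasSum_sum_splits ((hasSum_headSlope hb hτ).sub hb)
  have h2 : HasSum (boundaryTerm d x c) (iota d / (1 + mbar d x)) := by
    rw [← cutoffSurfaceTerm_eq hd c hΛ hM]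
    refine hasSum_single Insertions.nil fun l hl => ?_
    cases l with
    | nil => exact absurd rfl hl
    | cons => rfl
  refine hτ.unique ((hasSum_congr_real fun l => ?_).2 ((h1.sub h2).mul_left (-2 * x.2.1)))
  rw [← integral_lineDeriv hd hΛ hM]
  rfl

/-- The geometric series of chains of bubbles. -/
theorem fourPoint_schwingerDyson {x : Params} {c : Fin d} {g : ℝ} (hlam : x.2.1 ≠ 0)
    (hg : HasSum (fourPointAmp d x c) g) :
    ∃ b, HasSum (bubble d x c) b ∧ g = 4 * x.2.1 + -2 * x.2.1 * b * g := by
  have hcons : ∀ t l, fourPointAmp d x c (t :: l) =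
      -2 * x.2.1 * (bubble d x c t * fourPointAmp d x c l) := by
    intro t l
    simp only [fourPointAmp, bubble, List.map_cons, List.prod_cons]
    ring
  have hnil : fourPointAmp d x c [] = 4 * x.2.1 := by simp [fourPointAmp]
  have hs : Summable (bubble d x c) := by
    -- The one-bubble chains form a subfamily equal to `-8λ²` times the bubbles, so `λ ≠ 0` gives
    -- convergence of the bubble series.
    have h := hg.summable.comp_injective (i := fun t => [t]) fun s t h => by simpa using h
    refine (h.mul_left ((-8 * x.2.1 ^ 2)⁻¹)).congr fun t => ?_
    simp only [Function.comp_apply, hcons, hnil]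
    field_simp
    ring
  obtain ⟨b, hb⟩ := hs
  refine ⟨b, hb, hg.unique ?_⟩
  have h := (hb.mul hg (summable_mul_of_summable_norm hb.summable.norm
    hg.summable.norm)).mul_left (-2 * x.2.1)
  let i : (Insertions d × Insertions d) × List (Insertions d × Insertions d) →
    List (Insertions d × Insertions d) := fun u => u.1 :: u.2
  have hi : Function.Injective i := by
    rintro ⟨s, l⟩ ⟨t, m⟩ h
    simpa [i] using h
  have h' : HasSum (fun l => if l = [] then 0 else fourPointAmp d x c l)
      (-2 * x.2.1 * (b * g)) := by
    rw [← hi.hasSum_iff]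
    · refine (hasSum_congr_real fun u => ?_).2 h
      simp [i, hcons]
    · rintro (_ | ⟨t, l⟩) hl
      · simp
      · exact absurd ⟨(t, l), rfl⟩ hl
  convert (hasSum_ite_eq ([] : List (Insertions d × Insertions d)) (4 * x.2.1)).add h' using 1
  · funext l
    split_ifs with hl
    · simp [hl, hnil]
    · simp
  · ring

/-- The melonic vertex functions in terms of the chain of dressed bubbles. -/
theorem exists_vertexFunctions_eq (hd : 3 < d) {x : Params} (hΛ : 0 < x.1) (hM : 0 < x.2.2)
    {c : Fin d} {Z g : ℝ} (hZ : HasSum (slopeAmp d x c) (1 - Z))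
    (hg : HasSum (fourPointAmp d x c) g) :
    ∃ a, g * (1 - a) = 4 * x.2.1 ∧
      Z * (1 - a) * (1 + mbar d x) = 1 + mbar d x - 2 * x.2.1 * iota d := by
  have hm : 1 + mbar d x ≠ 0 := by
    have := cutoffPow_pos (d := d) hΛ
    rw [one_add_mbar hΛ]
    positivity
  -- At zero coupling the hypotheses say nothing about the bubble series, but all amplitudes vanish
  -- and `a = 0` works.
  by_cases hlam : x.2.1 = 0
  · have hZ0 : 1 - Z = 0 := hZ.unique (by
      have : slopeAmp d x c = fun _ => 0 := by funext s; simp [slopeAmp, hlam]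
      exact this ▸ hasSum_zero)
    have hg0 : g = 0 := hg.unique (by
      have : fourPointAmp d x c = fun _ => 0 := by funext s; simp [fourPointAmp, hlam]
      exact this ▸ hasSum_zero)
    refine ⟨0, by simp [hg0, hlam], ?_⟩
    rw [hlam, ← sub_eq_zero.1 hZ0]
    ring
  · obtain ⟨b, hb, hgb⟩ := fourPoint_schwingerDyson hlam hg
    have h := slope_schwingerDyson hd hΛ hM hb hZ
    refine ⟨-2 * x.2.1 * b, by linear_combination hgb, ?_⟩
    field_simp at h
    linear_combination -h

/-! ### Ward identity and analytic continuation -/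

theorem analyticAt_mbar {x : Params} (hΛ : 0 < x.1) : AnalyticAt ℝ (mbar d) x := by
  have h1 : AnalyticAt ℝ (fun x : Params => x.1) x := analyticAt_fst
  have h2 : AnalyticAt ℝ (fun x : Params => x.2.2) x := analyticAt_snd.comp analyticAt_snd
  have h3 : AnalyticAt ℝ (cutoffPow d) x := by
    have h : AnalyticAt ℝ (fun y : Params => Real.log y.1) x :=
      (analyticAt_log hΛ).comp_of_eq h1 rfl
    refine (h.mul (analyticAt_const (v := 2 * eta d))).rexp.congr ?_
    filter_upwards [(isOpen_lt continuous_const continuous_fst).mem_nhds hΛ] with y hy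
    exact (Real.rpow_def_of_pos hy _).symm
  exact h2.div h3 (cutoffPow_pos hΛ).ne'

theorem analyticAt_coupling (x : Params) : AnalyticAt ℝ (fun x : Params => x.2.1) x :=
  analyticAt_fst.comp analyticAt_snd

/-- The Ward identity relating the melonic two- and four-point functions at zero momentum. -/
theorem IsMelonicVertexFunctions.ward_identity (hd : 3 < d) {c : Fin d} {U : Set Params}
    {Z g4 : Params → ℝ} (h : IsMelonicVertexFunctions d c U Z g4) :
    Set.EqOn (fun x => 4 * x.2.1 * (1 + mbar d x) * Z x)
      (fun x => g4 x * (1 + mbar d x - 2 * x.2.1 * iota d)) U := by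
  obtain ⟨V, hVU, hVo, ⟨x₀, hx₀⟩, hV⟩ := h.expansion
  refine AnalyticOnNhd.eqOn_of_preconnected_of_eventuallyEq (𝕜 := ℝ) (z₀ := x₀) ?_ ?_
    h.isPreconnected (hVU hx₀) ?_
  · exact fun x hx => ((analyticAt_const.mul (analyticAt_coupling x)).mul
      (analyticAt_const.add (analyticAt_mbar (h.cutoff_pos x hx)))).mul (h.analytic_Z x hx)
  · exact fun x hx => (h.analytic_g4 x hx).mul
      ((analyticAt_const.add (analyticAt_mbar (h.cutoff_pos x hx))).sub
        ((analyticAt_const.mul (analyticAt_coupling x)).mul analyticAt_const))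
  · filter_upwards [hVo.mem_nhds hx₀] with x hx
    obtain ⟨hM, hZ, hg⟩ := hV x hx
    obtain ⟨a, h1, h2⟩ := exists_vertexFunctions_eq hd (h.cutoff_pos x (hVU hx)) hM hZ hg
    linear_combination g4 x * h2 - (1 + mbar d x) * Z x * h1

/-- `Z` vanishes on no open part of the region. -/
theorem IsMelonicVertexFunctions.subset_closure_ne_zero (hd : 3 < d) {c : Fin d}
    {U : Set Params} {Z g4 : Params → ℝ} (h : IsMelonicVertexFunctions d c U Z g4) :
    U ⊆ closure {x ∈ U | Z x ≠ 0} := by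
  intro x hx
  by_contra hcl
  have hZ : Set.EqOn Z 0 U := by
    refine h.analytic_Z.eqOn_zero_of_preconnected_of_eventuallyEq_zero h.isPreconnected hx ?_
    filter_upwards [h.isOpen.mem_nhds hx, isClosed_closure.isOpen_compl.mem_nhds hcl] with y hy hy'
    by_contra hne
    exact hy' (subset_closure ⟨hy, hne⟩)
  obtain ⟨V, hVU, hVo, ⟨x₀, hx₀⟩, hV⟩ := h.expansion
  have hzero : ∀ y ∈ V, 1 + mbar d y - 2 * y.2.1 * iota d = 0 := by
    intro y hy
    obtain ⟨hM, hZy, hg⟩ := hV y hy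
    obtain ⟨a, -, h2⟩ := exists_vertexFunctions_eq hd (h.cutoff_pos y (hVU hy)) hM hZy hg
    rw [← h2, hZ (hVU hy)]
    simp
  -- The expression in `hzero` is affine in `λ` with slope `-2ι ≠ 0`, so varying `λ` alone inside
  -- `V` contradicts its vanishing.
  have hcont : Continuous fun t : ℝ => ((x₀.1, x₀.2.1 + t, x₀.2.2) : Params) := by fun_prop
  have hnear : ∀ᶠ t in nhdsWithin (0 : ℝ) {0}ᶜ, ((x₀.1, x₀.2.1 + t, x₀.2.2) : Params) ∈ V :=
    (hcont.continuousAt.eventually_mem (hVo.mem_nhds (by simpa using hx₀))).filter_mono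
      nhdsWithin_le_nhds
  obtain ⟨t, htV, ht⟩ := (hnear.and self_mem_nhdsWithin).exists
  have h1 := hzero _ hx₀
  have h2 := hzero _ htV
  have h3 : mbar d (x₀.1, x₀.2.1 + t, x₀.2.2) = mbar d x₀ := rfl
  rw [h3] at h2
  have h4 : t * iota d = 0 := by linear_combination (h1 - h2) / 2
  exact (mul_ne_zero ht (iota_pos hd).ne') h4

/-! ### The Callan–Symanzik flow and the fixed points -/

/-- Derivative along the Callan–Symanzik flow. -/
theorem hasDerivAt_flow {F : Params → ℝ} {x : Params} (hF : DifferentiableAt ℝ F x) (b m : ℝ) :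
    HasDerivAt (fun t : ℝ => F (x + t • (x.1, b, m)))
      (x.1 * fderiv ℝ F x (1, 0, 0) + b * fderiv ℝ F x (0, 1, 0) +
        m * fderiv ℝ F x (0, 0, 1)) 0 := by
  have hv : ((x.1, b, m) : Params) =
      x.1 • ((1, 0, 0) : Params) + b • ((0, 1, 0) : Params) + m • ((0, 0, 1) : Params) := by
    simp
  have hl : HasDerivAt (fun t : ℝ => x + t • ((x.1, b, m) : Params)) (x.1, b, m) 0 := by
    simpa using ((hasDerivAt_id (0 : ℝ)).smul_const ((x.1, b, m) : Params)).const_add x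
  have hF' : HasFDerivAt F (fderiv ℝ F x) (x + (0 : ℝ) • ((x.1, b, m) : Params)) := by
    simpa using hF.hasFDerivAt
  have := hF'.comp_hasDerivAt (0 : ℝ) hl
  rw [hv, map_add, map_add, map_smul, map_smul, map_smul] at this
  rw [hv]
  exact this

theorem hasDerivAt_mbar_flow {x : Params} (hΛ : 0 < x.1) (b : ℝ) (βm : Params → ℝ) :
    HasDerivAt (fun t : ℝ => mbar d (x + t • (x.1, b, βm x))) (betaMbar d βm x) 0 := by
  have hc := cutoffPow_pos (d := d) hΛ
  have h1 : HasDerivAt (fun t : ℝ => x.1 + t * x.1) x.1 0 := by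
    simpa using ((hasDerivAt_id (0 : ℝ)).mul_const x.1).const_add x.1
  have h2 : HasDerivAt (fun t : ℝ => x.2.2 + t * βm x) (βm x) 0 := by
    simpa using ((hasDerivAt_id (0 : ℝ)).mul_const (βm x)).const_add x.2.2
  have h3 := h1.rpow_const (p := 2 * eta d) (Or.inl (by simpa using hΛ.ne'))
  have h4 := h2.div h3 (by simpa using (Real.rpow_pos_of_pos hΛ (2 * eta d)).ne')
  refine h4.congr_deriv ?_
  have h5 : x.1 ^ (2 * eta d - 1) = cutoffPow d x / x.1 := Real.rpow_sub_one hΛ.ne' _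
  have h6 : x.1 ^ (2 * eta d) = cutoffPow d x := rfl
  simp only [zero_mul, add_zero, h5, h6, betaMbar]
  field_simp

/-- The Ward identity is differentiated along the vector field `(Λ, β, β_m)`. Multiplying by `1 + m̄
- 2λι` lets the identity itself turn every `γ⁽⁴⁾` into `Z`, which is then cancelled. The result
involves only functions that are continuous up to the boundary of `U` where `Λ > 0`. -/
theorem callanSymanzik_flow {U : Set Params} {c : Fin d} {Z g4 β βm γ : Params → ℝ} (hd : 3 < d)
    (h : IsMelonicVertexFunctions d c U Z g4) {x : Params} (hx : x ∈ U) (hZ : Z x ≠ 0)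
    (hCS2 : CallanSymanzik β βm γ 2 Z x) (hCS4 : CallanSymanzik β βm γ 4 g4 x) :
    (1 + mbar d x - 2 * x.2.1 * iota d) *
        (4 * β x * (1 + mbar d x) + 4 * x.2.1 * betaMbar d βm x) -
      4 * x.2.1 * (1 + mbar d x) * (betaMbar d βm x - 2 * β x * iota d) =
    γ x * (4 * x.2.1 * (1 + mbar d x)) * (1 + mbar d x - 2 * x.2.1 * iota d) := by
  have hdZ := hasDerivAt_flow (h.analytic_Z x hx).differentiableAt (β x) (βm x)
  have hdg := hasDerivAt_flow (h.analytic_g4 x hx).differentiableAt (β x) (βm x)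
  have hdm := hasDerivAt_mbar_flow (d := d) (h.cutoff_pos x hx) (β x) βm
  have hdl : HasDerivAt (fun t : ℝ => (x + t • ((x.1, β x, βm x) : Params)).2.1) (β x) 0 := by
    simpa using ((hasDerivAt_id (0 : ℝ)).mul_const (β x)).const_add x.2.1
  have hL := ((hdl.const_mul 4).mul (hdm.const_add 1)).mul hdZ
  have hR := hdg.mul ((hdm.const_add 1).sub ((hdl.const_mul 2).mul_const (iota d)))
  have hline : Continuous fun t : ℝ => x + t • ((x.1, β x, βm x) : Params) := by fun_prop
  have hev : ∀ᶠ t in nhds (0 : ℝ), x + t • ((x.1, β x, βm x) : Params) ∈ U :=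
    hline.continuousAt.eventually_mem (h.isOpen.mem_nhds (by simpa using hx))
  have heq := hL.unique (hR.congr_of_eventuallyEq
    (hev.mono fun t ht => h.ward_identity hd ht))
  have hward := h.ward_identity hd hx
  unfold CallanSymanzik at hCS2 hCS4
  simp only [zero_smul, add_zero, Pi.mul_apply, Pi.sub_apply] at heq hward
  norm_num at hCS2 hCS4
  refine mul_left_cancel₀ hZ ?_
  generalize 1 + mbar d x = k at *
  generalize betaMbar d βm x = e at *
  rw [sub_eq_zero.1 hCS2, sub_eq_zero.1 hCS4] at heq
  linear_combination (k - 2 * x.2.1 * iota d) * heq -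
    (2 * γ x * (k - 2 * x.2.1 * iota d) + (e - 2 * β x * iota d)) * hward

end TGFT

theorem mainTheorem9 (d : ℕ) (hd : 3 < d) (c : Fin d)
    (U W : Set TGFT.Params) (Z g4 : TGFT.Params → ℝ)
    (hmelonic : TGFT.IsMelonicVertexFunctions d c U Z g4)
    (hUW : U ⊆ W) (hWU : W ⊆ closure U)
    (β βm γ : TGFT.Params → ℝ)
    (hβ : ContinuousOn β W) (hβm : ContinuousOn βm W) (hγ : ContinuousOn γ W)
    (hCS2 : ∀ x ∈ U, TGFT.CallanSymanzik β βm γ 2 Z x)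
    (hCS4 : ∀ x ∈ U, TGFT.CallanSymanzik β βm γ 4 g4 x)
    (x : TGFT.Params) (hx : x ∈ W) (hΛ : 0 < x.1)
    (hm : 1 + TGFT.mbar d x ≠ 0)
    (hsing : 1 + TGFT.mbar d x - 2 * x.2.1 * TGFT.iota d ≠ 0)
    (hfix : β x = 0) (hfixm : TGFT.betaMbar d βm x = 0) :
    x.2.1 = 0 ∨ γ x = 0 := by
  set T : Set TGFT.Params := {y ∈ W | 0 < y.1} with hT
  have hTW : T ⊆ W := fun y hy => hy.1
  have hβT := hβ.mono hTW
  have hβmT := hβm.mono hTW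
  have hγT := hγ.mono hTW
  have hmT : ContinuousOn (TGFT.mbar d) T := fun y hy =>
    (TGFT.analyticAt_mbar hy.2).continuousAt.continuousWithinAt
  have hlT : ContinuousOn (fun y : TGFT.Params => y.2.1) T := by fun_prop
  have hbT : ContinuousOn (TGFT.betaMbar d βm) T := by
    refine ContinuousOn.div (hβmT.sub (by fun_prop)) ?_ fun y hy => (TGFT.cutoffPow_pos hy.2).ne'
    exact continuousOn_fst.rpow_const fun y hy => Or.inl hy.2.ne'
  -- Neither `Z` nor `γ⁽⁴⁾` is defined meaningfully on the boundary of `U`, so it is the relation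
  -- free of both that is extended from the dense set where `Z ≠ 0`.
  have key := Set.EqOn.of_subset_closure (s := {y ∈ U | Z y ≠ 0}) (t := T)
    (f := fun x => (1 + TGFT.mbar d x - 2 * x.2.1 * TGFT.iota d) *
        (4 * β x * (1 + TGFT.mbar d x) + 4 * x.2.1 * TGFT.betaMbar d βm x) -
      4 * x.2.1 * (1 + TGFT.mbar d x) * (TGFT.betaMbar d βm x - 2 * β x * TGFT.iota d))
    (g := fun x => γ x * (4 * x.2.1 * (1 + TGFT.mbar d x)) *
      (1 + TGFT.mbar d x - 2 * x.2.1 * TGFT.iota d))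
    (fun y hy => TGFT.callanSymanzik_flow hd hmelonic hy.1 hy.2 (hCS2 y hy.1) (hCS4 y hy.1))
    (by fun_prop) (by fun_prop)
    (fun y hy => ⟨hUW hy.1, hmelonic.cutoff_pos y hy.1⟩)
    (fun y hy => closure_minimal (hmelonic.subset_closure_ne_zero hd) isClosed_closure
      (hWU hy.1))
  have hxT := key (show x ∈ T from ⟨hx, hΛ⟩)
  simp only [hfix, hfixm] at hxT
  ring_nf at hxT
  by_contra! hne
  have : γ x * (4 * x.2.1 * (1 + TGFT.mbar d x)) *
      (1 + TGFT.mbar d x - 2 * x.2.1 * TGFT.iota d) = 0 := by linear_combination -hxT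
  exact mul_ne_zero (mul_ne_zero hne.2 (mul_ne_zero (mul_ne_zero four_ne_zero hne.1) hm)) hsing this
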